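/- Let $n\ge 0$, let $F_n$ be the free group on $x_1,\dots,x_n$, let $\varphi\in\mathrm{Aut}(F_n)$, and let $$G=F_n\rtimes_\varphi\mathbb{Z}=\langle x_1,\dots,x_n,t \mid t^{-1}x_it=\varphi(x_i),\ 1\le i\le n\rangle .$$ Let $[\overline\varphi]\in \mathrm{GL}_n(\mathbb{Z})$ be the matrix, in the basis given by the classes of $x_1,\dots,x_n$, of the automorphism $\overline\varphi$ of the abelianization $F_n/[F_n,F_n]\cong\mathbb{Z}^n$ induced by $\varphi$. For a class $\mathcal C$ of groups, a group $G$ is residually $\mathcal C$ if for every $g\in G$ with $g\neq 1$ there is a homomorphism $f$ from $G$ to a group in $\mathcal C$ with $f(g)\ne 1$; residually nilpotent and residually $p$-finite mean that $\mathcal C$ is the class of nilpotent groups and of finite $p$-groups, respectively. Suppose that all complex eigenvalues of $[\overline\varphi]$ are integers. Then $G$ is residually nilpotent. Moreover: a) if all eigenvalues of $[\overline\varphi]$ are equal to $1$, then $G$ is residually $p$-finite for every prime $p$; b) if at least one eigenvalue of $[\overline\varphi]$ is equal to $-1$, then $G$ is residually $2$-finite. -/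

import Mathlib

/-- `G` is residually a `C`-group: every non-identity element of `G` has non-trivial image under
some homomorphism from `G` to a group of the class `C`. -/
def IsResidually (C : (H : Type) → [Group H] → Prop) (G : Type) [Group G] : Prop :=
  ∀ g : G, g ≠ 1 → ∃ (H : Type) (_ : Group H), C H ∧ ∃ f : G →* H, f g ≠ 1

/-- `G` is residually nilpotent. -/
def IsResiduallyNilpotent (G : Type) [Group G] : Prop :=
  IsResidually (fun H _ => Group.IsNilpotent H) G

/-- `G` is residually `p`-finite, i.e. residually a finite `p`-group. -/
def IsResiduallyPFinite (p : ℕ) (G : Type) [Group G] : Prop :=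
  IsResidually (fun H _ => Finite H ∧ IsPGroup p H) G

/-- The group `F_n ⋊_φ ℤ = ⟨x₁, …, xₙ, t | t⁻¹ xᵢ t = φ(xᵢ)⟩`. In Mathlib's semidirect product the
generator `t` acts by `t x t⁻¹`, so it has to act by `φ⁻¹`; see `FreeByCyclic.conj_stable`. -/
abbrev FreeByCyclic {n : ℕ} (φ : MulAut (FreeGroup (Fin n))) : Type :=
  FreeGroup (Fin n) ⋊[zpowersHom (MulAut (FreeGroup (Fin n))) φ⁻¹] Multiplicative ℤ

/-- The defining relation `t⁻¹ x t = φ(x)`. -/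
theorem FreeByCyclic.conj_stable {n : ℕ} (φ : MulAut (FreeGroup (Fin n)))
    (x : FreeGroup (Fin n)) :
    (SemidirectProduct.inr (Multiplicative.ofAdd 1) : FreeByCyclic φ)⁻¹ *
        SemidirectProduct.inl x * SemidirectProduct.inr (Multiplicative.ofAdd 1) =
      SemidirectProduct.inl (φ x) := by
  rw [← map_inv, ← SemidirectProduct.inl_aut_inv]
  simp

/-- The automorphism of the abelianization of `F_n` (the free `ℤ`-module on `x₁, …, xₙ`, written
additively) induced by `φ`. -/
noncomputable def abAut {n : ℕ} (φ : MulAut (FreeGroup (Fin n))) :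
    FreeAbelianGroup (Fin n) ≃ₗ[ℤ] FreeAbelianGroup (Fin n) :=
  AddEquiv.toIntLinearEquiv
    (MulEquiv.toAdditive (MulEquiv.abelianizationCongr φ) :
      FreeAbelianGroup (Fin n) ≃+ FreeAbelianGroup (Fin n))

/-- `abAut φ` maps the class of `x` to the class of `φ x`. -/
theorem abAut_apply {n : ℕ} (φ : MulAut (FreeGroup (Fin n))) (x : FreeGroup (Fin n)) :
    abAut φ (Additive.ofMul (Abelianization.of x) : Additive (Abelianization _)) =
      (Additive.ofMul (Abelianization.of (φ x)) : Additive (Abelianization _)) :=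
  rfl

/-- The matrix in `GL_n(ℤ)` of `abAut φ` in the basis given by the classes of `x₁, …, xₙ`. -/
noncomputable def abMatrix {n : ℕ} (φ : MulAut (FreeGroup (Fin n))) :
    Matrix.GeneralLinearGroup (Fin n) ℤ where
  val := LinearMap.toMatrix (FreeAbelianGroup.basis (Fin n)) (FreeAbelianGroup.basis (Fin n))
    (abAut φ).toLinearMap
  inv := LinearMap.toMatrix (FreeAbelianGroup.basis (Fin n)) (FreeAbelianGroup.basis (Fin n))
    (abAut φ).symm.toLinearMap
  val_inv := by
    rw [← LinearMap.toMatrix_comp, LinearEquiv.comp_symm, LinearMap.toMatrix_id]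
  inv_val := by
    rw [← LinearMap.toMatrix_comp, LinearEquiv.symm_comp, LinearMap.toMatrix_id]

/-- The complex number `μ` is an eigenvalue of the integer matrix `A`. -/
def IsComplexEigenvalue {n : ℕ} (A : Matrix (Fin n) (Fin n) ℤ) (μ : ℂ) : Prop :=
  Module.End.HasEigenvalue (Matrix.toLin' (A.map (Int.cast : ℤ → ℂ))) μ

/-! Fix a prime `p` and suppose that the eigenvalues are integers congruent to 1 mod `p`. Then the
matrix mod `p` is unipotent, so ψ = φ^(p^n) acts trivially on the abelianization mod `p`, hence on
I/I², where I is the augmentation ideal of 𝔽_p[F_n]. So ψ - 1 raises the I-adic filtration, and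
ψ^(p^s) - 1 = (ψ - 1)^(p^s) sends group elements into I^(p^s). A unitriangular representation over
𝔽_p of degree at most p^s kills I^(p^s), so it is invariant under ψ^(p^s). Each g ≠ 1 in F_n
survives in such a representation, built from its reduced word (`wordRep_toWord_ne_one`). An
invariant map to a finite `p`-group induces a map of the whole extension to a wreath product with a
cyclic `p`-group; elements outside F_n are detected in ℤ. Integer eigenvalues of an invertible
integer matrix are ±1, and both are 1 mod 2. So p = 2 always works, which gives residual nilpotence;
if all eigenvalues are 1, every `p` works. -/

/-! ### Reduction to invariant `p`-quotients of the fibre -/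

/-- The homomorphism from `N ⋊ ℤ` to the wreath product of `P` by `ℤ/q` induced by a homomorphism
`f : N →* P` invariant under the `q`-th power of the defining automorphism. -/
theorem exists_hom_regularWreathProduct {N P : Type} [Group N] [Group P] (φ : MulAut N) (q : ℕ)
    (f : N →* P) (hf : ∀ x, f ((φ ^ q) x) = f x) :
    ∃ F : N ⋊[zpowersHom (MulAut N) φ⁻¹] Multiplicative ℤ →*
        RegularWreathProduct P (Multiplicative (ZMod q)),
      ∀ x, f x ≠ 1 → F (SemidirectProduct.inl x) ≠ 1 := by
  have hz : ∀ (a : ℤ) x, f (((φ ^ q) ^ a) x) = f x := by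
    intro a
    induction a using Int.induction_on with
    | zero => simp
    | succ i ih => intro x; rw [zpow_add_one, MulAut.mul_apply, ih, hf]
    | pred i ih =>
      intro x
      rw [zpow_sub_one, MulAut.mul_apply, ih, ← hf, MulAut.apply_inv_self]
  have hcongr : ∀ (a b : ℤ) x, (a : ZMod q) = b → f ((φ ^ a) x) = f ((φ ^ b) x) := by
    intro a b x h
    obtain ⟨c, hc⟩ := (ZMod.intCast_eq_intCast_iff_dvd_sub a b q).1 h
    have hb : b = q * c + a := by omega
    rw [hb, zpow_add, MulAut.mul_apply, zpow_mul, zpow_natCast, hz]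
  -- An element x goes to its orbit function i ↦ f(φ^i x); by `hcongr` the integer chosen to
  -- represent i is immaterial.
  let f₁ : N →* RegularWreathProduct P (Multiplicative (ZMod q)) :=
    { toFun := fun x => ⟨fun i => f ((φ ^ (i.toAdd.cast : ℤ)) x), 1⟩
      map_one' := by ext <;> simp
      map_mul' := fun x y => by ext <;> simp }
  refine ⟨SemidirectProduct.lift f₁ (RegularWreathProduct.inl.comp
    (AddMonoidHom.toMultiplicative (Int.castAddHom (ZMod q)))) ?_, ?_⟩
  · intro g
    ext x i
    · have hx : (φ ^ (i.toAdd.cast : ℤ)) ((φ⁻¹ ^ g.toAdd) x) =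
          (φ ^ ((i.toAdd.cast : ℤ) - g.toAdd)) x := by
        rw [zpow_sub, MulAut.mul_apply, inv_zpow]
      simp only [f₁, MonoidHom.comp_apply, MulEquiv.coe_toMonoidHom, MonoidHom.coe_mk,
        OneHom.coe_mk, zpowersHom_apply, MulAut.conj_apply, RegularWreathProduct.mul_left,
        RegularWreathProduct.left_inl, RegularWreathProduct.right_inl, Pi.mul_apply, Pi.one_apply,
        RegularWreathProduct.inv_left, inv_one, one_mul, mul_one]
      rw [hx]
      apply hcongr
      simp [sub_eq_neg_add]
    · simp [f₁]
  · intro x hx h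
    apply hx
    -- The coordinate at the identity of ℤ/q is f x itself.
    have h1 := congrFun (congrArg RegularWreathProduct.left h) 1
    simpa [f₁] using h1

theorem IsPGroup.regularWreathProduct {p : ℕ} [Fact p.Prime] {D Q : Type*} [Group D] [Group Q]
    [Finite D] [Finite Q] (hD : IsPGroup p D) (hQ : IsPGroup p Q) :
    IsPGroup p (RegularWreathProduct D Q) := by
  obtain ⟨a, ha⟩ := IsPGroup.iff_card.1 hD
  obtain ⟨b, hb⟩ := IsPGroup.iff_card.1 hQ
  refine IsPGroup.iff_card.2 ⟨a * p ^ b + b, ?_⟩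
  rw [RegularWreathProduct.card, ha, hb, pow_add, pow_mul]

theorem isPGroup_multiplicative_zmod {p : ℕ} [Fact p.Prime] (k : ℕ) :
    IsPGroup p (Multiplicative (ZMod (p ^ k))) :=
  IsPGroup.iff_card.2 ⟨k, by simp⟩

/-- An extension `N ⋊ ℤ` is residually `p`-finite if the elements of `N` are separated by
homomorphisms to finite `p`-groups invariant under a `p`-power of the automorphism. -/
theorem isResiduallyPFinite_semidirectProduct_int {N : Type} [Group N] (φ : MulAut N) {p : ℕ}
    [Fact p.Prime]
    (H : ∀ x : N, x ≠ 1 → ∃ (P : Type) (_ : Group P) (f : N →* P) (k : ℕ), Finite P ∧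
      IsPGroup p P ∧ f x ≠ 1 ∧ ∀ y, f ((φ ^ p ^ k) y) = f y) :
    IsResiduallyPFinite p (N ⋊[zpowersHom (MulAut N) φ⁻¹] Multiplicative ℤ) := by
  intro g hg
  by_cases hr : g.right = 1
  · have hg' : g = SemidirectProduct.inl g.left := by
      ext <;> simp [hr]
    have hl : g.left ≠ 1 := by
      intro h
      rw [hg', h, map_one] at hg
      exact hg rfl
    obtain ⟨P, _, f, k, hfin, hP, hfg, hinv⟩ := H _ hl
    obtain ⟨F, hF⟩ := exists_hom_regularWreathProduct φ (p ^ k) f hinv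
    have : NeZero (p ^ k) := ⟨pow_ne_zero _ (Fact.out : p.Prime).ne_zero⟩
    have : Finite (Multiplicative (ZMod (p ^ k))) := inferInstanceAs (Finite (ZMod (p ^ k)))
    refine ⟨_, inferInstance, ⟨inferInstance,
      hP.regularWreathProduct (isPGroup_multiplicative_zmod k)⟩, F, ?_⟩
    rw [hg']
    exact hF _ hfg
  -- The modulus p^|a| exceeds |a|, so a ≠ 0 survives in ℤ/p^|a|.
  · set a : ℤ := g.right.toAdd with ha
    have ha0 : a ≠ 0 := hr
    have : NeZero (p ^ a.natAbs) := ⟨pow_ne_zero _ (Fact.out : p.Prime).ne_zero⟩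
    refine ⟨Multiplicative (ZMod (p ^ a.natAbs)), inferInstance,
      ⟨inferInstanceAs (Finite (ZMod (p ^ a.natAbs))), isPGroup_multiplicative_zmod _⟩,
      (AddMonoidHom.toMultiplicative (Int.castAddHom (ZMod (p ^ a.natAbs)))).comp
        SemidirectProduct.rightHom, ?_⟩
    intro h
    have h1 : ((a : ℤ) : ZMod (p ^ a.natAbs)) = 0 := h
    rw [ZMod.intCast_zmod_eq_zero_iff_dvd, Int.natCast_dvd] at h1
    exact absurd (Nat.le_of_dvd (Int.natAbs_pos.2 ha0) h1)
      (not_le.2 (Nat.lt_pow_self (Fact.out : p.Prime).one_lt))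

/-! ### The augmentation filtration in characteristic `p` -/

/-- The augmentation ideal of a group algebra, as a submodule. -/
noncomputable def augmentationSubmodule (k G : Type*) [CommRing k] [Group G] :
    Submodule k (MonoidAlgebra k G) :=
  Submodule.span k (Set.range fun g => MonoidAlgebra.of k G g - 1)

section
variable {k G : Type*} [CommRing k] [Group G]

theorem of_sub_one_mem_augmentationSubmodule (g : G) :
    MonoidAlgebra.of k G g - 1 ∈ augmentationSubmodule k G :=
  Submodule.subset_span ⟨g, rfl⟩

theorem of_sub_of_mem_augmentationSubmodule (g h : G) :
    MonoidAlgebra.of k G g - MonoidAlgebra.of k G h ∈ augmentationSubmodule k G := by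
  simpa using sub_mem (of_sub_one_mem_augmentationSubmodule (k := k) g)
    (of_sub_one_mem_augmentationSubmodule h)

theorem of_mul_sub_mem_augmentationSubmodule_sq (g h : G) :
    MonoidAlgebra.of k G (g * h) - 1 - ((MonoidAlgebra.of k G g - 1) +
      (MonoidAlgebra.of k G h - 1)) ∈ augmentationSubmodule k G ^ 2 := by
  have h1 := Submodule.mul_mem_mul (of_sub_one_mem_augmentationSubmodule (k := k) g)
    (of_sub_one_mem_augmentationSubmodule (k := k) h)
  rw [← pow_two] at h1
  convert h1 using 1
  rw [map_mul]
  noncomm_ring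

/-- The homomorphism `g ↦ g - 1` from a group to the augmentation ideal modulo its square. -/
noncomputable def toAugmentationQuotient (k G : Type*) [CommRing k] [Group G] :
    G →* Multiplicative (MonoidAlgebra k G ⧸ augmentationSubmodule k G ^ 2) where
  toFun g := Multiplicative.ofAdd (Submodule.Quotient.mk (MonoidAlgebra.of k G g - 1))
  map_one' := by rw [map_one, sub_self]; rfl
  map_mul' g h := by
    rw [← ofAdd_add, ← Submodule.Quotient.mk_add]
    exact congrArg _ ((Submodule.Quotient.eq _).2 (of_mul_sub_mem_augmentationSubmodule_sq g h))

/-- The map g ↦ g - 1 modulo I² has an abelian target of exponent `p`, so it factors through the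
abelianization and kills `p`-th powers. -/
theorem of_sub_of_mem_augmentationSubmodule_sq {p : ℕ} [CharP k p] {x y z : G}
    (h : Abelianization.of y = Abelianization.of x * Abelianization.of z ^ p) :
    MonoidAlgebra.of k G y - MonoidAlgebra.of k G x ∈ augmentationSubmodule k G ^ 2 := by
  have h1 := congrArg (Abelianization.lift (toAugmentationQuotient k G)) h
  have h2 : toAugmentationQuotient k G z ^ p = 1 := by
    change p • (Submodule.Quotient.mk (MonoidAlgebra.of k G z - 1) :
      MonoidAlgebra k G ⧸ augmentationSubmodule k G ^ 2) = 0
    rw [← Nat.cast_smul_eq_nsmul k, CharP.cast_eq_zero, zero_smul]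
  rw [map_mul, map_pow, Abelianization.lift_apply_of, Abelianization.lift_apply_of,
    Abelianization.lift_apply_of, h2, mul_one] at h1
  have h3 := (Submodule.Quotient.eq _).1 h1
  simpa using h3

/-- If `ψ` acts trivially on `I / I²`, then `ψ - 1` maps `I ^ j` to `I ^ (j + 1)`. -/
theorem mapDomainAlgHom_sub_mem (ψ : G →* G)
    (hψ : ∀ x, MonoidAlgebra.of k G (ψ x) - MonoidAlgebra.of k G x ∈
      augmentationSubmodule k G ^ 2) (j : ℕ) (a : MonoidAlgebra k G)
    (ha : a ∈ augmentationSubmodule k G ^ (j + 1)) :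
    MonoidAlgebra.mapDomainAlgHom k k ψ a ∈ augmentationSubmodule k G ^ (j + 1) ∧
    MonoidAlgebra.mapDomainAlgHom k k ψ a - a ∈ augmentationSubmodule k G ^ (j + 2) := by
  set Φ := MonoidAlgebra.mapDomainAlgHom k k ψ with hΦ
  have hof : ∀ x, Φ (MonoidAlgebra.of k G x) = MonoidAlgebra.of k G (ψ x) := by
    intro x; simp [hΦ]
  have base : ∀ a ∈ augmentationSubmodule k G, Φ a ∈ augmentationSubmodule k G ∧
      Φ a - a ∈ augmentationSubmodule k G ^ 2 := by
    intro a ha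
    induction ha using Submodule.span_induction with
    | mem x hx =>
      obtain ⟨g, rfl⟩ := hx
      simp only [map_sub, map_one, hof, sub_sub_sub_cancel_right]
      exact ⟨of_sub_one_mem_augmentationSubmodule _, hψ g⟩
    | zero => simp
    | add x y _ _ hx hy =>
      rw [map_add, add_sub_add_comm]
      exact ⟨add_mem hx.1 hy.1, add_mem hx.2 hy.2⟩
    | smul c x _ hx =>
      rw [map_smul, ← smul_sub]
      exact ⟨Submodule.smul_mem _ _ hx.1, Submodule.smul_mem _ _ hx.2⟩
  induction j generalizing a with
  | zero => simpa using base a (by simpa using ha)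
  | succ j ih =>
    rw [pow_succ'] at ha
    induction ha using Submodule.mul_induction_on' with
    | mem_mul_mem a ha b hb =>
      obtain ⟨h1, h2⟩ := base a ha
      obtain ⟨h3, h4⟩ := ih b hb
      refine ⟨?_, ?_⟩
      · rw [map_mul, pow_succ']
        exact Submodule.mul_mem_mul h1 h3
      -- Twisted Leibniz rule: each summand gains one power of I.
      · have e : Φ (a * b) - a * b = (Φ a - a) * Φ b + a * (Φ b - b) := by
          rw [map_mul]; noncomm_ring
        rw [e]
        refine add_mem ?_ ?_
        · have := Submodule.mul_mem_mul h2 h3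
          rwa [← pow_add, show 2 + (j + 1) = j + 1 + 2 by omega] at this
        · rw [show j + 1 + 2 = (j + 2) + 1 by omega, pow_succ']
          exact Submodule.mul_mem_mul ha h4
    | add x _ y _ hx hy =>
      rw [map_add, add_sub_add_comm]
      exact ⟨add_mem hx.1 hy.1, add_mem hx.2 hy.2⟩

/-- If `ψ` acts trivially on `I / I²`, then its `p ^ s`-th power acts trivially modulo
`I ^ (p ^ s)` in characteristic `p`. -/
theorem of_pow_char_pow_sub_of_mem {p : ℕ} [Fact p.Prime] (ψ : MulAut G)
    (hψ : ∀ x, MonoidAlgebra.of (ZMod p) G (ψ x) - MonoidAlgebra.of (ZMod p) G x ∈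
      augmentationSubmodule (ZMod p) G ^ 2) (s : ℕ) (x : G) :
    MonoidAlgebra.of (ZMod p) G ((ψ ^ p ^ s) x) - MonoidAlgebra.of (ZMod p) G x ∈
      augmentationSubmodule (ZMod p) G ^ (p ^ s) := by
  let Φ : Module.End (ZMod p) (MonoidAlgebra (ZMod p) G) :=
    (MonoidAlgebra.mapDomainAlgHom (ZMod p) (ZMod p) ψ.toMonoidHom).toLinearMap
  have hΦ : ∀ x, Φ (MonoidAlgebra.of (ZMod p) G x) = MonoidAlgebra.of (ZMod p) G (ψ x) := by
    intro x; simp [Φ]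
  have hpow : ∀ (m : ℕ) x, (Φ ^ m) (MonoidAlgebra.of (ZMod p) G x) =
      MonoidAlgebra.of (ZMod p) G ((ψ ^ m) x) := by
    intro m
    induction m with
    | zero => simp
    | succ m ih => intro x; rw [pow_succ, Module.End.mul_apply, hΦ, ih, pow_succ, MulAut.mul_apply]
  -- The count starts at exponent 1: `of x` need not lie in I, but ψ(x) - x does.
  have hdelta : ∀ m, ((Φ - 1) ^ (m + 1)) (MonoidAlgebra.of (ZMod p) G x) ∈
      augmentationSubmodule (ZMod p) G ^ (m + 1) := by
    intro m
    induction m with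
    | zero =>
      rw [zero_add, pow_one, pow_one, LinearMap.sub_apply, hΦ, Module.End.one_apply]
      exact of_sub_of_mem_augmentationSubmodule _ _
    | succ m ih =>
      rw [pow_succ' (Φ - 1), Module.End.mul_apply]
      exact (mapDomainAlgHom_sub_mem ψ.toMonoidHom hψ m _ ih).2
  have hchar : (Φ - 1) ^ p ^ s = Φ ^ p ^ s - 1 := by
    have : CharP (Module.End (ZMod p) (MonoidAlgebra (ZMod p) G)) p :=
      charP_of_injective_algebraMap (R := ZMod p) (algebraMap (ZMod p) _).injective p
    rw [sub_pow_char_pow_of_commute _ _ (Commute.one_right Φ), one_pow]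
  obtain ⟨m, hm⟩ := Nat.exists_eq_succ_of_ne_zero
    (pow_ne_zero s (Fact.out : p.Prime).ne_zero)
  have h := hdelta m
  rw [← Nat.succ_eq_add_one, ← hm, hchar, LinearMap.sub_apply, hpow, Module.End.one_apply] at h
  exact h

end

/-! ### Unitriangular matrices -/

/-- Matrices supported on and above the `d`-th superdiagonal. -/
def superdiagonalSubmodule (K : Type*) [CommRing K] (m d : ℕ) :
    Submodule K (Matrix (Fin m) (Fin m) K) where
  carrier := {M | ∀ i j : Fin m, (j : ℕ) < i + d → M i j = 0}
  add_mem' {A B} hA hB i j h := by simp [hA i j h, hB i j h]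
  zero_mem' i j _ := rfl
  smul_mem' c A hA i j h := by simp [hA i j h]

section
variable {K : Type*} [CommRing K] {m : ℕ}

theorem mul_mem_superdiagonalSubmodule {d e : ℕ} {A B : Matrix (Fin m) (Fin m) K}
    (hA : A ∈ superdiagonalSubmodule K m d) (hB : B ∈ superdiagonalSubmodule K m e) :
    A * B ∈ superdiagonalSubmodule K m (d + e) := by
  intro i j h
  rw [Matrix.mul_apply]
  refine Finset.sum_eq_zero fun l _ => ?_
  by_cases hl : (l : ℕ) < i + d
  · rw [hA i l hl, zero_mul]
  · rw [hB l j (by omega), mul_zero]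

theorem pow_superdiagonalSubmodule_le (d : ℕ) :
    superdiagonalSubmodule K m 1 ^ (d + 1) ≤ superdiagonalSubmodule K m (d + 1) := by
  induction d with
  | zero => simp
  | succ d ih =>
    rw [pow_succ, Submodule.mul_le]
    exact fun a ha b hb => mul_mem_superdiagonalSubmodule (ih ha) hb

theorem superdiagonalSubmodule_eq_bot {d : ℕ} (h : m ≤ d) :
    superdiagonalSubmodule K m d = ⊥ := by
  refine (Submodule.eq_bot_iff _).2 fun A hA => ?_
  ext i j
  exact hA i j (by omega)

theorem pow_superdiagonalSubmodule_eq_bot {d : ℕ} (h : m ≤ d) (hd : d ≠ 0) :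
    superdiagonalSubmodule K m 1 ^ d = ⊥ := by
  obtain ⟨e, rfl⟩ := Nat.exists_eq_succ_of_ne_zero hd
  exact eq_bot_iff.2 ((pow_superdiagonalSubmodule_le e).trans
    (superdiagonalSubmodule_eq_bot h).le)

theorem isNilpotent_of_mem_superdiagonalSubmodule {A : Matrix (Fin m) (Fin m) K}
    (hA : A ∈ superdiagonalSubmodule K m 1) : IsNilpotent A := by
  refine ⟨m + 1, ?_⟩
  have h := Submodule.pow_mem_pow _ hA (m + 1)
  rwa [pow_superdiagonalSubmodule_eq_bot (Nat.le_succ m) (Nat.succ_ne_zero m)] at h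

end

/-- The group of upper unitriangular matrices. -/
def unitriangularSubgroup (K : Type*) [CommRing K] [Finite K] (m : ℕ) :
    Subgroup (Matrix (Fin m) (Fin m) K)ˣ :=
  let S : Submonoid (Matrix (Fin m) (Fin m) K)ˣ :=
    { carrier := {u | (u : Matrix (Fin m) (Fin m) K) - 1 ∈ superdiagonalSubmodule K m 1}
      one_mem' := by simp
      mul_mem' := by
        intro u v hu hv
        have e : ((u * v : (Matrix (Fin m) (Fin m) K)ˣ) : Matrix (Fin m) (Fin m) K) - 1 =
            (u - 1) * (v - 1) + (u - 1) + (v - 1) := by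
          rw [Units.val_mul]; noncomm_ring
        have h2 : ((u : Matrix (Fin m) (Fin m) K) - 1) * (v - 1) ∈
            superdiagonalSubmodule K m 1 := fun i j h =>
          mul_mem_superdiagonalSubmodule hu hv i j (by omega)
        rw [Set.mem_ofPred_eq, e]
        exact add_mem (add_mem h2 hu) hv }
  { S with
    inv_mem' := by
      intro u hu
      have : Finite (Matrix (Fin m) (Fin m) K)ˣ := inferInstance
      -- The unit group is finite, so closure under products already gives inverses.
      have h : u⁻¹ = u ^ (orderOf u - 1) := by
        rw [eq_comm, eq_inv_iff_mul_eq_one, ← pow_succ,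
          Nat.sub_add_cancel (orderOf_pos u), pow_orderOf_eq_one]
      rw [h]
      exact S.pow_mem hu _ }

theorem mem_unitriangularSubgroup {K : Type*} [CommRing K] [Finite K] {m : ℕ}
    {u : (Matrix (Fin m) (Fin m) K)ˣ} : u ∈ unitriangularSubgroup K m ↔
      (u : Matrix (Fin m) (Fin m) K) - 1 ∈ superdiagonalSubmodule K m 1 := Iff.rfl

/-! ### A representation detecting a reduced word -/

section
variable {α : Type*} (K : Type*) [CommRing K] [DecidableEq α] (w : List (α × Bool))

/-- The nilpotent matrix with an entry `1` at `(r, r + 1)` for each occurrence of the letter `a`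
at position `r` of the word `w`. -/
def letterMatrix (a : α × Bool) : Matrix (Fin (w.length + 1)) (Fin (w.length + 1)) K :=
  fun i j => if (j : ℕ) = i + 1 ∧ w[(i : ℕ)]? = some a then 1 else 0

theorem letterMatrix_mem (a : α × Bool) :
    letterMatrix K w a ∈ superdiagonalSubmodule K _ 1 := by
  intro i j h
  simp only [letterMatrix]
  rw [if_neg]
  omega

/-- A nonzero entry of the product would need a letter followed at once by its inverse in `w`. -/
theorem letterMatrix_mul_letterMatrix {w : List (α × Bool)} (hw : FreeGroup.IsReduced w)
    (i : α) (b : Bool) :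
    letterMatrix K w (i, b) * letterMatrix K w (i, !b) = 0 := by
  ext r c
  rw [Matrix.mul_apply]
  refine Finset.sum_eq_zero fun l _ => ?_
  simp only [letterMatrix]
  by_cases h1 : (l : ℕ) = r + 1 ∧ w[(r : ℕ)]? = some (i, b)
  · by_cases h2 : (c : ℕ) = l + 1 ∧ w[(l : ℕ)]? = some (i, !b)
    · exfalso
      obtain ⟨h3, h4⟩ := h1
      obtain ⟨-, h5⟩ := h2
      rw [h3] at h5
      obtain ⟨h6, h7⟩ := List.getElem?_eq_some_iff.1 h4
      obtain ⟨h8, h9⟩ := List.getElem?_eq_some_iff.1 h5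
      have := List.isChain_iff_getElem.1 hw r h8
      rw [h7, h9] at this
      simp at this
    · rw [if_neg h2, mul_zero]
  · rw [if_neg h1, zero_mul]

/-- The unipotent matrix attached to a letter. -/
noncomputable def letterUnit (a : α × Bool) :
    (Matrix (Fin (w.length + 1)) (Fin (w.length + 1)) K)ˣ :=
  (isNilpotent_of_mem_superdiagonalSubmodule (letterMatrix_mem K w a)).isUnit_one_add.unit

theorem coe_letterUnit (a : α × Bool) :
    (letterUnit K w a : Matrix (Fin (w.length + 1)) (Fin (w.length + 1)) K) =
      1 + letterMatrix K w a := rfl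

theorem commute_letterUnit {w : List (α × Bool)} (hw : FreeGroup.IsReduced w)
    (i : α) : Commute (letterUnit K w (i, true)) (letterUnit K w (i, false)) := by
  ext1
  have h1 := letterMatrix_mul_letterMatrix K hw i true
  have h2 := letterMatrix_mul_letterMatrix K hw i false
  simp only [Bool.not_true, Bool.not_false] at h1 h2
  simp only [Units.val_mul, coe_letterUnit, mul_add, add_mul, mul_one, one_mul, h1, h2]
  abel

/-- A Magnus-type representation of a free group by unipotent matrices, attached to a word. -/
noncomputable def wordRep : FreeGroup α →* (Matrix (Fin (w.length + 1)) (Fin (w.length + 1)) K)ˣ :=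
  FreeGroup.lift fun i => letterUnit K w (i, true) * (letterUnit K w (i, false))⁻¹

/-- Commutation gives generators and their inverses the same shape, so later arguments need not
split on the sign of a letter. -/
theorem wordRep_mk_singleton {w : List (α × Bool)} (hw : FreeGroup.IsReduced w) (a : α × Bool) :
    wordRep K w (FreeGroup.mk [a]) =
      (letterUnit K w (a.1, !a.2))⁻¹ * letterUnit K w a := by
  obtain ⟨i, b⟩ := a
  have h := commute_letterUnit K hw i
  cases b
  · simp [wordRep, h.inv_left.eq]
  · simp [wordRep, h.inv_right.eq]

theorem vecMul_letterMatrix (v : Fin (w.length + 1) → K) (a : α × Bool)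
    (c : Fin (w.length + 1)) :
    Matrix.vecMul v (letterMatrix K w a) c =
      if _ : (c : ℕ) ≠ 0 ∧ w[(c : ℕ) - 1]? = some a then v ⟨c - 1, by omega⟩ else 0 := by
  rw [Matrix.vecMul, dotProduct]
  split_ifs with h
  · rw [Finset.sum_eq_single (⟨c - 1, by omega⟩ : Fin (w.length + 1))]
    · simp only [letterMatrix]
      rw [if_pos ⟨by omega, h.2⟩, mul_one]
    · intro b _ hb
      simp only [letterMatrix]
      rw [if_neg, mul_zero]
      rintro ⟨h1, -⟩
      apply hb
      ext
      simp [h1]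
    · simp
  · refine Finset.sum_eq_zero fun b _ => ?_
    simp only [letterMatrix]
    rw [if_neg, mul_zero]
    rintro ⟨h1, h2⟩
    apply h
    rw [h1]
    exact ⟨by omega, by simpa using h2⟩

/-- Reading the letter at position j moves the last nonzero coordinate, a 1, from j to j + 1. The
factor of the opposite letter leaves it at j because `w` is reduced; the factor of the letter itself
then shifts it. -/
theorem vecMul_wordRep_letter {w : List (α × Bool)} (hw : FreeGroup.IsReduced w) {j : ℕ}
    (hj : j < w.length) (v : Fin (w.length + 1) → K)
    (hv : v ⟨j, by omega⟩ = 1) (hv' : ∀ c : Fin (w.length + 1), j < c → v c = 0) :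
    let v' := Matrix.vecMul v (wordRep K w (FreeGroup.mk [w[j]])).val
    v' ⟨j + 1, by omega⟩ = 1 ∧ ∀ c : Fin (w.length + 1), j + 1 < c → v' c = 0 := by
  intro v'
  set a := w[j] with ha
  set u := Matrix.vecMul v ((letterUnit K w (a.1, !a.2))⁻¹).val with hu
  have hv'u : v' = u + Matrix.vecMul u (letterMatrix K w a) := by
    simp only [v', u]
    rw [wordRep_mk_singleton K hw, Units.val_mul, ← Matrix.vecMul_vecMul, coe_letterUnit,
      Matrix.vecMul_add, Matrix.vecMul_one]
  have huv : v = u + Matrix.vecMul u (letterMatrix K w (a.1, !a.2)) := by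
    have h : Matrix.vecMul u (letterUnit K w (a.1, !a.2)).val = v := by
      rw [hu, Matrix.vecMul_vecMul, Units.inv_mul, Matrix.vecMul_one]
    rw [coe_letterUnit, Matrix.vecMul_add, Matrix.vecMul_one] at h
    exact h.symm
  -- This determines u from left to right, with no formula for the inverse matrix.
  have huc : ∀ c, u c = v c - Matrix.vecMul u (letterMatrix K w (a.1, !a.2)) c := by
    intro c
    rw [eq_sub_iff_add_eq]
    exact (congrFun huv c).symm
  have hwj : w[j]? = some a := by rw [List.getElem?_eq_getElem hj]
  have huj : u ⟨j, by omega⟩ = 1 := by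
    rw [huc, hv, vecMul_letterMatrix, dif_neg, sub_zero]
    rintro ⟨h1, h2⟩
    simp only at h1 h2
    obtain ⟨h6, h7⟩ := List.getElem?_eq_some_iff.1 h2
    have := List.isChain_iff_getElem.1 hw (j - 1) (by omega)
    rw [h7] at this
    simp [Nat.sub_add_cancel (Nat.pos_of_ne_zero h1), ← ha] at this
  have hu0 : ∀ (d : ℕ) (hd : j + 1 + d < w.length + 1), u ⟨j + 1 + d, hd⟩ = 0 := by
    intro d
    induction d with
    | zero =>
      intro hd
      rw [huc, hv' _ (by simp), vecMul_letterMatrix, dif_neg, sub_zero]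
      rintro ⟨h1, h2⟩
      simp only [add_zero, Nat.add_sub_cancel, hwj, Option.some.injEq] at h2
      have := congrArg Prod.snd h2
      simp at this
    | succ d ih =>
      intro hd
      rw [huc, hv' _ (by simp; omega), vecMul_letterMatrix, zero_sub, neg_eq_zero]
      split_ifs
      · exact ih (by omega)
      · rfl
  have hu0' : ∀ c : Fin (w.length + 1), j < c → u c = 0 := by
    intro c hc
    have := hu0 (c - (j + 1)) (by omega)
    rw [← this]
    congr 1
    ext
    simp only
    omega
  rw [hv'u]
  refine ⟨?_, fun c hc => ?_⟩
  · rw [Pi.add_apply, hu0' _ (by simp), zero_add, vecMul_letterMatrix, dif_pos]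
    · exact huj
    · exact ⟨by simp, by simpa using hwj⟩
  · rw [Pi.add_apply, hu0' _ (by omega), zero_add, vecMul_letterMatrix]
    split_ifs
    · exact hu0' _ (by simp only; omega)
    · rfl

theorem vecMul_wordRep_take {w : List (α × Bool)} (hw : FreeGroup.IsReduced w) (j : ℕ)
    (hj : j ≤ w.length) :
    let v := Matrix.vecMul (Pi.single 0 1) (wordRep K w (FreeGroup.mk (w.take j))).val
    v ⟨j, by omega⟩ = 1 ∧ ∀ c : Fin (w.length + 1), j < c → v c = 0 := by
  induction j with
  | zero =>
    simp only [List.take_zero, ← FreeGroup.one_eq_mk, map_one, Units.val_one, Matrix.vecMul_one]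
    refine ⟨by simp, fun c hc => ?_⟩
    rw [Pi.single_eq_of_ne]
    rintro rfl
    simp at hc
  | succ j ih =>
    have ih' := ih (by omega)
    have e : (FreeGroup.mk (w.take (j + 1))) =
        FreeGroup.mk (w.take j) * FreeGroup.mk [w[j]] := by
      rw [FreeGroup.mul_mk, List.take_append_getElem]
    intro v
    have hv : v = Matrix.vecMul (Matrix.vecMul (Pi.single 0 1)
        (wordRep K w (FreeGroup.mk (w.take j))).val) (wordRep K w (FreeGroup.mk [w[j]])).val := by
      simp only [v]
      rw [Matrix.vecMul_vecMul, e, map_mul, Units.val_mul]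
    rw [hv]
    exact vecMul_wordRep_letter K hw (by omega) _ ih'.1 ih'.2

/-- Reading the whole word puts a 1 in the last column of row 0, off the diagonal since the word is
nonempty. -/
theorem wordRep_toWord_ne_one [Nontrivial K] {g : FreeGroup α} (hg : g ≠ 1) :
    wordRep K g.toWord g ≠ 1 := by
  intro h
  have h1 := (vecMul_wordRep_take K (FreeGroup.isReduced_toWord (x := g)) _ le_rfl).1
  simp only [List.take_length, FreeGroup.mk_toWord, h, Units.val_one, Matrix.vecMul_one] at h1
  rw [Pi.single_eq_of_ne] at h1
  · exact zero_ne_one h1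
  · intro h2
    have := congrArg Fin.val h2
    simp only [Fin.val_zero, List.length_eq_zero_iff, FreeGroup.toWord_eq_nil_iff] at this
    exact hg this

theorem wordRep_mem [Finite K] (g : FreeGroup α) :
    wordRep K w g ∈ unitriangularSubgroup K (w.length + 1) := by
  have hl : ∀ a, letterUnit K w a ∈ unitriangularSubgroup K (w.length + 1) := by
    intro a
    rw [mem_unitriangularSubgroup, coe_letterUnit, add_sub_cancel_left]
    exact letterMatrix_mem K w a
  induction g using FreeGroup.induction_on with
  | C1 => simp
  | of i => simpa [wordRep] using mul_mem (hl (i, true)) (inv_mem (hl (i, false)))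
  | inv_of i h => rw [map_inv]; exact inv_mem h
  | mul x y hx hy => rw [map_mul]; exact mul_mem hx hy

end

/-! ### Invariant homomorphisms of free groups to finite `p`-groups -/

/-- The linear extension of a unitriangular representation kills high powers of the
augmentation ideal. -/
theorem lift_eq_zero_of_mem_pow {K G : Type*} [CommRing K] [Finite K] [Group G] {m d : ℕ}
    (f : G →* (Matrix (Fin m) (Fin m) K)ˣ) (hf : ∀ g, f g ∈ unitriangularSubgroup K m)
    (hd : m ≤ d) (hd0 : d ≠ 0) (a : MonoidAlgebra K G) (ha : a ∈ augmentationSubmodule K G ^ d) :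
    MonoidAlgebra.lift K (Matrix (Fin m) (Fin m) K) G ((Units.coeHom _).comp f) a = 0 := by
  set F := MonoidAlgebra.lift K (Matrix (Fin m) (Fin m) K) G ((Units.coeHom _).comp f) with hF
  have h1 : (augmentationSubmodule K G).map F.toLinearMap ≤ superdiagonalSubmodule K m 1 := by
    rw [augmentationSubmodule, Submodule.map_span, Submodule.span_le]
    rintro _ ⟨_, ⟨g, rfl⟩, rfl⟩
    simpa [hF] using mem_unitriangularSubgroup.1 (hf g)
  have h2 : F a ∈ superdiagonalSubmodule K m 1 ^ d := by
    refine pow_le_pow_left' h1 d ?_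
    rw [← Submodule.map_pow]
    exact Submodule.mem_map_of_mem ha
  rwa [pow_superdiagonalSubmodule_eq_bot hd hd0] at h2

/-- If `ψ` acts trivially on the abelianization modulo `p`, then some `p`-power of `ψ` leaves
invariant a homomorphism to a finite `p`-group that does not kill a given element. -/
theorem FreeGroup.exists_invariant_hom {α : Type} {p : ℕ} [Fact p.Prime]
    (ψ : MulAut (FreeGroup α))
    (hψ : ∀ x, ∃ z, Abelianization.of (ψ x) = Abelianization.of x * Abelianization.of z ^ p)
    {g : FreeGroup α} (hg : g ≠ 1) :
    ∃ (P : Type) (_ : Group P) (f : FreeGroup α →* P) (s : ℕ), Finite P ∧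
      IsPGroup p P ∧ f g ≠ 1 ∧ ∀ y, f ((ψ ^ p ^ s) y) = f y := by
  classical
  set m := g.toWord.length + 1 with hm
  set f := wordRep (ZMod p) g.toWord with hf
  have hmem : ∀ x, f x ∈ unitriangularSubgroup (ZMod p) m := wordRep_mem _ _
  have hms : m ≤ p ^ m := (Nat.lt_pow_self (Fact.out : p.Prime).one_lt).le
  have hp0 : p ^ m ≠ 0 := pow_ne_zero _ (Fact.out : p.Prime).ne_zero
  refine ⟨f.range, inferInstance, f.rangeRestrict, m, inferInstance, ?_, ?_, ?_⟩
  · rintro ⟨_, x, rfl⟩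
    refine ⟨m, ?_⟩
    ext1
    ext1
    -- In characteristic `p`, u^(p^m) - 1 = (u - 1)^(p^m), which vanishes as m ≤ p^m.
    have h1 := Submodule.pow_mem_pow _ (mem_unitriangularSubgroup.1 (hmem x)) (p ^ m)
    rw [pow_superdiagonalSubmodule_eq_bot hms hp0, Submodule.mem_bot,
      sub_pow_char_pow_of_commute _ _ (Commute.one_right _), one_pow, sub_eq_zero] at h1
    simpa using h1
  · intro h
    exact wordRep_toWord_ne_one (ZMod p) hg (congrArg Subtype.val h)
  · intro y
    have hI : ∀ x, MonoidAlgebra.of (ZMod p) (FreeGroup α) (ψ x) -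
        MonoidAlgebra.of (ZMod p) (FreeGroup α) x ∈ augmentationSubmodule _ _ ^ 2 := by
      intro x
      obtain ⟨z, hz⟩ := hψ x
      exact of_sub_of_mem_augmentationSubmodule_sq hz
    have h := lift_eq_zero_of_mem_pow f hmem hms hp0 _ (of_pow_char_pow_sub_of_mem ψ hI m y)
    rw [map_sub, sub_eq_zero, MonoidAlgebra.lift_of, MonoidAlgebra.lift_of] at h
    ext1
    ext1
    exact h

/-! ### From integer eigenvalues to the action mod `p` -/

open Polynomial in
/-- A square integer matrix whose complex eigenvalues are integers congruent to `1` modulo `p`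
is unipotent modulo `p`. -/
theorem sub_one_pow_map_zmod_eq_zero {n p : ℕ} (A : Matrix (Fin n) (Fin n) ℤ)
    (hA : ∀ μ : ℂ, IsComplexEigenvalue A μ → ∃ k : ℤ, μ = k ∧ (k : ZMod p) = 1) :
    (A.map (Int.cast : ℤ → ZMod p) - 1) ^ n = 0 := by
  set f := A.charpoly with hf
  have hroot : ∀ z ∈ (f.map (Int.castRingHom ℂ)).roots, ∃ k : ℤ, z = k ∧ (k : ZMod p) = 1 := by
    intro z hz
    apply hA
    rw [IsComplexEigenvalue, Module.End.hasEigenvalue_iff_isRoot_charpoly,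
      Matrix.charpoly_toLin']
    have h := (Polynomial.mem_roots'.1 hz).2
    rw [hf, ← Matrix.charpoly_map] at h
    exact h
  choose! r hr hr1 using hroot
  set s := (f.map (Int.castRingHom ℂ)).roots with hs
  have hmonic : f.Monic := Matrix.charpoly_monic A
  -- As the roots are integers, the complex factorization descends to ℤ and can be reduced mod `p`;
  -- Cayley–Hamilton then applies.
  have hprod : f = (s.map fun z => X - C (r z)).prod := by
    apply Polynomial.map_injective (Int.castRingHom ℂ) Int.cast_injective
    rw [Polynomial.map_multiset_prod, Multiset.map_map]
    conv_lhs => rw [(IsAlgClosed.splits (f.map (Int.castRingHom ℂ))).eq_prod_roots_of_monic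
      (hmonic.map _)]
    congr 1
    refine Multiset.map_congr rfl fun z hz => ?_
    rw [Function.comp_apply, Polynomial.map_sub, Polynomial.map_X, Polynomial.map_C,
      eq_intCast (Int.castRingHom _)]
    rw [← hr z hz]
  have hcard : Multiset.card s = n := by
    rw [hs, ← (IsAlgClosed.splits (f.map (Int.castRingHom ℂ))).natDegree_eq_card_roots,
      hmonic.natDegree_map, hf, Matrix.charpoly_natDegree_eq_dim, Fintype.card_fin]
  have hmap : (A.map (Int.cast : ℤ → ZMod p)).charpoly = (X - C 1) ^ n := by
    have h : (A.map (Int.cast : ℤ → ZMod p)).charpoly = f.map (Int.castRingHom (ZMod p)) :=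
      Matrix.charpoly_map A (Int.castRingHom (ZMod p))
    rw [h, hprod, Polynomial.map_multiset_prod, Multiset.map_map, ← hcard,
      ← Multiset.prod_replicate, ← Multiset.map_const']
    congr 1
    refine Multiset.map_congr rfl fun z hz => ?_
    rw [Function.comp_apply, Polynomial.map_sub, Polynomial.map_X, Polynomial.map_C,
      eq_intCast (Int.castRingHom _)]
    rw [hr1 z hz]
  have h := Matrix.aeval_self_charpoly (A.map (Int.cast : ℤ → ZMod p))
  rw [hmap] at h
  simpa using h

/-- The integer eigenvalues of an invertible integer matrix are `1` or `-1`. -/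
theorem eq_one_or_neg_one_of_isComplexEigenvalue {n : ℕ} (A : Matrix.GeneralLinearGroup (Fin n) ℤ)
    {k : ℤ} (hk : IsComplexEigenvalue A.val k) : k = 1 ∨ k = -1 := by
  rw [IsComplexEigenvalue, Module.End.hasEigenvalue_iff_isRoot_charpoly,
    Matrix.charpoly_toLin'] at hk
  have h0 : A.val.charpoly.eval k = 0 := by
    have h1 : (A.val.map (Int.cast : ℤ → ℂ)).charpoly =
      A.val.charpoly.map (Int.castRingHom ℂ) := Matrix.charpoly_map A.val (Int.castRingHom ℂ)
    rw [h1, Polynomial.IsRoot.def, ← eq_intCast (Int.castRingHom ℂ) k, Polynomial.eval_map_apply]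
      at hk
    exact (RingHom.injective_int (Int.castRingHom ℂ)) (hk.trans (map_zero _).symm)
  -- A root k divides the constant term det(-A), which is a unit.
  have hd : k ∣ A.val.charpoly.eval 0 := by
    have := Polynomial.sub_dvd_eval_sub k 0 A.val.charpoly
    rwa [h0, sub_zero, zero_sub, dvd_neg] at this
  have hu : IsUnit (A.val.charpoly.eval 0) := by
    rw [Matrix.eval_charpoly]
    have : IsUnit (-A.val) := (Units.isUnit A).neg
    simpa using (Matrix.isUnit_iff_isUnit_det _).1 this
  exact Int.isUnit_iff.1 (isUnit_of_dvd_unit hd hu)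

theorem pow_map_zmod_eq_one {n p : ℕ} [Fact p.Prime] (A : Matrix (Fin n) (Fin n) ℤ)
    (hA : (A.map (Int.cast : ℤ → ZMod p) - 1) ^ n = 0) :
    (A ^ p ^ n).map (Int.cast : ℤ → ZMod p) = 1 := by
  have h1 : (A ^ p ^ n).map (Int.cast : ℤ → ZMod p) = (A.map (Int.cast : ℤ → ZMod p)) ^ p ^ n :=
    Matrix.map_pow A (Int.castRingHom (ZMod p)) _
  -- For n = 0 the matrix ring is trivial and does not have characteristic `p`.
  rcases n.eq_zero_or_pos with rfl | hn
  · exact Subsingleton.elim _ _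
  have : Nonempty (Fin n) := ⟨⟨0, hn⟩⟩
  have h2 := sub_pow_char_pow_of_commute (p := p) n
    (Commute.one_right (A.map (Int.cast : ℤ → ZMod p)))
  rw [pow_eq_zero_of_le (Nat.lt_pow_self (Fact.out : p.Prime).one_lt).le hA, one_pow] at h2
  rw [h1]
  exact (sub_eq_zero.1 h2.symm)

/-- The induced map of φ^m minus the identity is `p` times an integral endomorphism; z lifts the
value of that endomorphism at the class of x. -/
theorem exists_abelianization_of_pow_eq {n p m : ℕ} (φ : MulAut (FreeGroup (Fin n)))
    (h : ((abMatrix φ).val ^ m).map (Int.cast : ℤ → ZMod p) = 1) (x : FreeGroup (Fin n)) :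
    ∃ z, Abelianization.of ((φ ^ m) x) = Abelianization.of x * Abelianization.of z ^ p := by
  set b := FreeAbelianGroup.basis (Fin n)
  obtain ⟨cls, hφ, hsurj, hcls⟩ : ∃ cls : FreeGroup (Fin n) → FreeAbelianGroup (Fin n),
      (∀ x, (abAut φ).toLinearMap (cls x) = cls (φ x)) ∧ Function.Surjective cls ∧
      ∀ (x y z : FreeGroup (Fin n)) (m : ℕ), cls x = cls y + m • cls z →
        Abelianization.of x = Abelianization.of y * Abelianization.of z ^ m :=
    ⟨fun x => (Additive.ofMul (Abelianization.of x) : Additive (Abelianization _)),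
      abAut_apply φ, QuotientGroup.mk_surjective, fun _ _ _ _ h => h⟩
  have hpow : ∀ (m : ℕ) (x : FreeGroup (Fin n)),
      ((abAut φ).toLinearMap ^ m) (cls x) = cls ((φ ^ m) x) := by
    intro m
    induction m with
    | zero => intro x; rfl
    | succ m ih =>
      intro x
      rw [pow_succ, Module.End.mul_apply, pow_succ, MulAut.mul_apply, ← ih, hφ]
  have hdvd : ∀ i j, (p : ℤ) ∣ ((abMatrix φ).val ^ m - 1) i j := by
    intro i j
    rw [← ZMod.intCast_zmod_eq_zero_iff_dvd]
    have h1 := congrFun (congrFun h i) j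
    rw [Matrix.map_apply] at h1
    rw [Matrix.sub_apply, Int.cast_sub, h1, sub_eq_zero]
    by_cases hij : i = j <;> simp [hij, Matrix.one_apply]
  choose B hB using hdvd
  have hmat : (abMatrix φ).val ^ m - 1 = (p : ℤ) • (Matrix.of B) := by
    ext i j
    simp [hB]
  have hlin : (abAut φ).toLinearMap ^ m - 1 = (p : ℤ) • Matrix.toLin b b (Matrix.of B) := by
    apply (LinearMap.toMatrix b b).injective
    rw [map_sub, ← LinearMap.toMatrix_pow, LinearMap.toMatrix_one, map_smul,
      LinearMap.toMatrix_toLin]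
    exact hmat
  obtain ⟨z, hz⟩ := hsurj (Matrix.toLin b b (Matrix.of B) (cls x))
  refine ⟨z, hcls _ _ _ _ ?_⟩
  have h2 := LinearMap.congr_fun hlin (cls x)
  rw [LinearMap.sub_apply, hpow, Module.End.one_apply, LinearMap.smul_apply, ← hz,
    sub_eq_iff_eq_add', natCast_zsmul] at h2
  exact h2

/-! ### The theorem -/

/-- The group `F_n ⋊ ℤ` is residually `p`-finite if the eigenvalues are integers congruent
to `1` modulo `p`. -/
theorem isResiduallyPFinite_freeByCyclic {n p : ℕ} [Fact p.Prime]
    (φ : MulAut (FreeGroup (Fin n)))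
    (hφ : ∀ μ : ℂ, IsComplexEigenvalue (abMatrix φ).val μ →
      ∃ k : ℤ, μ = k ∧ (k : ZMod p) = 1) :
    IsResiduallyPFinite p (FreeByCyclic φ) := by
  refine isResiduallyPFinite_semidirectProduct_int φ fun x hx => ?_
  have h := pow_map_zmod_eq_one _ (sub_one_pow_map_zmod_eq_zero _ hφ)
  obtain ⟨P, _, f, s, hfin, hP, hfx, hinv⟩ := FreeGroup.exists_invariant_hom (p := p)
    (φ ^ p ^ n) (exists_abelianization_of_pow_eq φ h) hx
  refine ⟨P, inferInstance, f, n + s, hfin, hP, hfx, fun y => ?_⟩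
  rw [pow_add, pow_mul]
  exact hinv y

theorem IsResiduallyPFinite.isResiduallyNilpotent {p : ℕ} [Fact p.Prime] {G : Type} [Group G]
    (h : IsResiduallyPFinite p G) : IsResiduallyNilpotent G := by
  intro g hg
  obtain ⟨H, _, ⟨hfin, hH⟩, f, hf⟩ := h g hg
  exact ⟨H, inferInstance, hH.isNilpotent, f, hf⟩

theorem mainTheorem6 (n : ℕ) (φ : MulAut (FreeGroup (Fin n)))
    (hφ : ∀ μ : ℂ, IsComplexEigenvalue (abMatrix φ).val μ → ∃ k : ℤ, μ = (k : ℂ)) :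
    IsResiduallyNilpotent (FreeByCyclic φ) ∧
    ((∀ μ : ℂ, IsComplexEigenvalue (abMatrix φ).val μ → μ = 1) →
      ∀ p : ℕ, p.Prime → IsResiduallyPFinite p (FreeByCyclic φ)) ∧
    (IsComplexEigenvalue (abMatrix φ).val (-1) →
      IsResiduallyPFinite 2 (FreeByCyclic φ)) := by
  have two : IsResiduallyPFinite 2 (FreeByCyclic φ) := by
    refine isResiduallyPFinite_freeByCyclic φ fun μ hμ => ?_
    obtain ⟨k, rfl⟩ := hφ μ hμ
    refine ⟨k, rfl, ?_⟩
    rcases eq_one_or_neg_one_of_isComplexEigenvalue _ hμ with rfl | rfl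
    · simp
    · decide
  refine ⟨two.isResiduallyNilpotent, fun h p hp => ?_, fun _ => two⟩
  have : Fact p.Prime := ⟨hp⟩
  exact isResiduallyPFinite_freeByCyclic φ fun μ hμ => ⟨1, by simp [h μ hμ], by simp⟩
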